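/- All graphs are finite and simple. A graph is $F$-free if it has no (not necessarily induced) subgraph isomorphic to $F$. The acyclic chromatic number $\chi_a(G)$ is the least $k$ such that $G$ has a proper $k$-colouring in which the union of any two colour classes induces a forest (equivalently, every cycle receives at least three colours). Theorem. There is an absolute constant $C>0$ such that the following holds. Let $F$ be a bipartite graph on $t \ge 4$ vertices that becomes a forest after deleting some single vertex. Then every $F$-free graph $G$ of maximum degree $\Delta \ge 1$ satisfies $$\chi_a(G) \;\le\; \bigl(1+\sqrt{8t-20}\bigr)\,\Delta \;\le\; C\sqrt{t}\,\Delta ;$$ in particular, $\chi_a(G) = O(\sqrt{t}\,\Delta)$ as $\Delta\to\infty$, with an absolute implied constant. -/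

import Mathlib

namespace SimpleGraph

/-- A graph is `k`-acyclic if it has a feedback vertex set of size `k`, that is, a set `X` of `k`
vertices whose deletion leaves a forest. -/
def IsKAcyclic {V : Type*} (G : SimpleGraph V) (k : ℕ) : Prop :=
  ∃ X : Finset V, X.card = k ∧ (G.induce {v | v ∉ X}).IsAcyclic

/-- A proper colouring is acyclic if any two colour classes together induce a forest. -/
def Coloring.IsAcyclicColoring {V α : Type*} {G : SimpleGraph V} (C : G.Coloring α) : Prop :=
  ∀ a b : α, (G.induce (C.colorClass a ∪ C.colorClass b)).IsAcyclic

/-- `G` has an acyclic (proper) colouring with `k` colours. -/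
def AcyclicColorable {V : Type*} (G : SimpleGraph V) (k : ℕ) : Prop :=
  ∃ C : G.Coloring (Fin k), C.IsAcyclicColoring

/-- The acyclic chromatic number: the least `k` such that `G` has an acyclic `k`-colouring.
For finite graphs the set is non-empty, see `acyclicColorable_acyclicChromaticNumber`. -/
noncomputable def acyclicChromaticNumber {V : Type*} (G : SimpleGraph V) : ℕ :=
  sInf {k | G.AcyclicColorable k}

/-- Giving all vertices different colours is an acyclic colouring. -/
theorem acyclicColorable_card {V : Type*} [Fintype V] (G : SimpleGraph V) :
    G.AcyclicColorable (Fintype.card V) := by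
  classical
  refine ⟨Coloring.mk (Fintype.equivFin V) fun {v w} h => by simpa using h.ne, ?_⟩
  intro a b v c hc
  have h3 := hc.three_le_length
  have hn := hc.support_nodup
  have hl : c.support.tail.length = c.length := by simp
  have hsub : (c.support.tail.map fun x => Fintype.equivFin V x.1).toFinset ⊆ {a, b} := by
    intro z hz
    simp only [List.mem_toFinset, List.mem_map] at hz
    obtain ⟨x, -, rfl⟩ := hz
    rw [Finset.mem_insert, Finset.mem_singleton]
    exact x.2
  have h1 := Finset.card_le_card hsub
  have hm : (c.support.tail.map fun x => Fintype.equivFin V x.1).Nodup :=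
    hn.map ((Fintype.equivFin V).injective.comp Subtype.val_injective)
  rw [List.toFinset_card_of_nodup hm, List.length_map, hl] at h1
  have h2 : ({a, b} : Finset (Fin (Fintype.card V))).card ≤ 2 := Finset.card_le_two
  omega

/-- The minimum in the definition of the acyclic chromatic number of a finite graph is attained. -/
theorem acyclicColorable_acyclicChromaticNumber {V : Type*} [Fintype V] (G : SimpleGraph V) :
    G.AcyclicColorable G.acyclicChromaticNumber :=
  Nat.sInf_mem (s := {k | G.AcyclicColorable k}) ⟨_, G.acyclicColorable_card⟩

end SimpleGraph

/-!
Colour the vertices with `k = ⌊(1 + √(8t - 20)) Δ⌋` colours and let `N S` be the number of maps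
from the vertices to the colours that are acyclic colourings on `S`. By induction on `S`, adding a
vertex `v` to `S` multiplies `N S` by at least `β / k`, where `β = s Δ` and `s = √(2t - 5)`
(`mul_numAcyclicColoringsOn_le_insert`); hence `N` is positive on the whole vertex set.

The colourings lost at `v` are of two kinds. Those giving `v` the colour of a neighbour number at
most `Δ N S / k`. In the others there is a two-coloured cycle through `v`. Such a cycle consists of
a path `q` of odd length `n` from some `u` to `v` and an edge `xy` with `x` adjacent to `u` and `y`
adjacent to `v`. The colours on `q` are determined by those of `x` and `y`, and by the induction
hypothesis erasing the `n` vertices of `q` other than `v` from `S` multiplies `N` by at most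
`(k / β) ^ n`, so a single cycle accounts for at most `N S / (k β ^ n)` colourings
(`card_alternatingColorings_le`).

There are at most `Δ ^ n` paths `q`, and this is where `F` enters: for a given `q` the number of
pairs `(x, y)` is at most `2 (t - 3) (Δ - 1)` rather than of order `Δ ^ 2`
(`Free.card_filter_adj_le`). Otherwise one finds subsets of the two neighbourhoods in which every
vertex has at least `t - 2` neighbours on the other side, and the forest `F - w` embeds greedily,
with the neighbours of the apex `w` going to neighbours of `v`; mapping `w` to `v` gives a copy of
`F`. The two neighbourhoods may overlap, but the greedy embedding is injective nevertheless.

Summing the geometric series over odd `n`, the total loss is at most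
`(Δ + s (Δ - 1)) N S / k`, since `s ^ 2 - 1 = 2 (t - 3)`. So it suffices that
`k ≥ Δ + 2 s Δ - s`, which holds because `2 s = √(8t - 20)` and `s > 1`.
-/

open Finset

namespace SimpleGraph

/-! ### Leaves of forests -/

/-- The first vertex of a longest path is a leaf. -/
theorem IsAcyclic.exists_leaf {U : Type*} [Finite U] {K : SimpleGraph U} (hK : K.IsAcyclic)
    {a b : U} (hab : K.Adj a b) : ∃ x y, K.Adj x y ∧ ∀ w, K.Adj x w → w = y := by
  classical
  have := Fintype.ofFinite U
  have : Nonempty U := ⟨a⟩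
  obtain ⟨u, v, p, hp, hmax⟩ := Walk.exists_isPath_forall_isPath_length_le_length K
  have hnil : ¬p.Nil := by
    intro h
    have h1 := hmax a b (Walk.cons hab Walk.nil) (by simp [hab.ne])
    have h2 : p.length = 0 := Walk.length_eq_zero_iff.mpr h
    simp [h2] at h1
  refine ⟨u, p.snd, p.adj_snd hnil, fun w hadj ↦ hK.eq_snd_of_adj_start hp hadj ?_⟩
  by_contra hw
  have h1 := hmax _ _ (p.cons hadj.symm) (hp.cons hw)
  simp at h1

theorem IsAcyclic.exists_leaf_finset {U : Type*} {K : SimpleGraph U} (hK : K.IsAcyclic)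
    {S : Finset U} {a b : U} (ha : a ∈ S) (hb : b ∈ S) (hab : K.Adj a b) :
    ∃ x ∈ S, ∃ y ∈ S, K.Adj x y ∧ ∀ w ∈ S, K.Adj x w → w = y := by
  obtain ⟨x, y, hxy, h⟩ := (hK.induce (S : Set U)).exists_leaf (a := ⟨a, ha⟩) (b := ⟨b, hb⟩) hab
  exact ⟨x, x.2, y, y.2, hxy, fun w hw hxw ↦ congrArg Subtype.val (h ⟨w, hw⟩ hxw)⟩

/-! ### Embedding forests into pairs of sets of large minimum degree -/

/-- Greedy embedding of a two-coloured forest `K` into a pair of (possibly overlapping) vertex sets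
`T false`, `T true` such that every vertex of either set has at least `d` neighbours in the other.
Leaves are removed one by one. The last vertex of a set of `d + 1` vertices can only be placed when
it is attached to an earlier one, whence the last hypothesis. -/
theorem IsAcyclic.exists_embedding_of_le_card_filter_adj {U V : Type*} [Nonempty V]
    {K : SimpleGraph U} (hK : K.IsAcyclic) (col : U → Bool)
    (hcol : ∀ a b, K.Adj a b → col b = !col a) (G : SimpleGraph V) [DecidableRel G.Adj]
    (T : Bool → Finset V) (d : ℕ) (hdeg : ∀ b, ∀ x ∈ T b, d ≤ #{y ∈ T (!b) | G.Adj x y})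
    (hcard : ∀ b, d ≤ #(T b)) (S : Finset U) (hS : #S ≤ d + 1)
    (hS' : #S ≤ d ∨ ∃ a ∈ S, ∃ b ∈ S, K.Adj a b) :
    ∃ f : U → V, Set.InjOn f S ∧ (∀ a ∈ S, f a ∈ T (col a)) ∧
      ∀ a ∈ S, ∀ b ∈ S, K.Adj a b → G.Adj (f a) (f b) := by
  classical
  induction hn : #S generalizing S with
  | zero =>
    obtain rfl := card_eq_zero.mp hn
    exact ⟨fun _ ↦ Classical.arbitrary V, by simp, by simp, by simp⟩
  | succ n ih =>
    suffices ∃ x ∈ S, ∀ f : U → V, (∀ a ∈ S.erase x, f a ∈ T (col a)) →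
        ∃ y ∈ T (col x), y ∉ (S.erase x).image f ∧
          ∀ w ∈ S.erase x, K.Adj x w → G.Adj y (f w) by
      obtain ⟨x, hx, H⟩ := this
      have hc : #(S.erase x) = n := by rw [card_erase_of_mem hx, hn]; rfl
      obtain ⟨f, hf1, hf2, hf3⟩ := ih (S.erase x) (by omega) (.inl (by omega)) hc
      obtain ⟨y, hy1, hy2, hy3⟩ := H f hf2
      have hy2' : ∀ a ∈ S, a ≠ x → f a ≠ y := fun a ha hax h ↦
        hy2 (mem_image.mpr ⟨a, mem_erase.mpr ⟨hax, ha⟩, h⟩)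
      refine ⟨Function.update f x y, ?_, ?_, ?_⟩
      · intro a ha b hb hab
        by_cases hax : a = x <;> by_cases hbx : b = x
        · rw [hax, hbx]
        · subst hax
          simp only [Function.update_self, Function.update_of_ne hbx] at hab
          exact absurd hab.symm (hy2' b hb hbx)
        · subst hbx
          simp only [Function.update_self, Function.update_of_ne hax] at hab
          exact absurd hab (hy2' a ha hax)
        · simp only [Function.update_of_ne hax, Function.update_of_ne hbx] at hab
          exact hf1 (by simp [hax, mem_coe.mp ha]) (by simp [hbx, mem_coe.mp hb]) hab
      · intro a ha
        by_cases hax : a = x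
        · subst hax; simpa using hy1
        · simpa [hax] using hf2 a (mem_erase.mpr ⟨hax, ha⟩)
      · intro a ha b hb hab
        by_cases hax : a = x <;> by_cases hbx : b = x
        · exact absurd (hax.trans hbx.symm) hab.ne
        · subst hax
          simpa [hbx] using hy3 b (mem_erase.mpr ⟨hbx, hb⟩) hab
        · subst hbx
          simpa [hax] using (hy3 a (mem_erase.mpr ⟨hax, ha⟩) hab.symm).symm
        · simpa [hax, hbx] using
            hf3 a (mem_erase.mpr ⟨hax, ha⟩) b (mem_erase.mpr ⟨hbx, hb⟩) hab
    by_cases he : ∃ a ∈ S, ∃ b ∈ S, K.Adj a b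
    · obtain ⟨a, ha, b, hb, hab⟩ := he
      obtain ⟨x, hx, p, hp, hxp, hu⟩ := hK.exists_leaf_finset ha hb hab
      refine ⟨x, hx, fun f hf ↦ ?_⟩
      have hp' : p ∈ S.erase x := mem_erase.mpr ⟨hxp.ne', hp⟩
      have hd := hdeg _ _ (hf p hp')
      rw [← hcol p x hxp.symm] at hd
      -- The image of the neighbour `p` is not one of its own neighbours, so it blocks nothing.
      have hlt : #(((S.erase x).image f).erase (f p)) < #{y ∈ T (col x) | G.Adj (f p) y} := by
        have h1 := card_image_le (s := S.erase x) (f := f)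
        rw [card_erase_of_mem hx] at h1
        have h2 := card_erase_add_one (mem_image_of_mem f hp')
        omega
      obtain ⟨y, hy, hy'⟩ := exists_mem_notMem_of_card_lt_card hlt
      rw [mem_filter] at hy
      refine ⟨y, hy.1, fun h ↦ hy' (mem_erase.mpr ⟨hy.2.ne', h⟩), fun w hw hxw ↦ ?_⟩
      rw [hu w (mem_of_mem_erase hw) hxw]
      exact hy.2.symm
    · obtain ⟨x, hx⟩ : S.Nonempty := card_pos.mp (by omega)
      refine ⟨x, hx, fun f hf ↦ ?_⟩
      have hlt : #((S.erase x).image f) < #(T (col x)) := by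
        have h1 := card_image_le (s := S.erase x) (f := f)
        rw [card_erase_of_mem hx] at h1
        have h2 := hcard (col x)
        have h3 := hS'.resolve_right he
        omega
      obtain ⟨y, hy, hy'⟩ := exists_mem_notMem_of_card_lt_card hlt
      exact ⟨y, hy, hy', fun w hw hxw ↦
        absurd ⟨x, hx, w, mem_of_mem_erase hw, hxw⟩ he⟩

/-- If there are more than `d (|A| + |B|)` adjacent pairs in `A × B`, then repeatedly deleting
vertices with at most `d` neighbours on the other side does not delete everything. -/
theorem exists_subset_forall_lt_card_filter_adj {V : Type*} (G : SimpleGraph V)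
    [DecidableRel G.Adj] (d : ℕ) (A B : Finset V)
    (h : d * (#A + #B) < #{p ∈ A ×ˢ B | G.Adj p.1 p.2}) :
    ∃ A' ⊆ A, ∃ B' ⊆ B, A'.Nonempty ∧ (∀ x ∈ A', d < #{y ∈ B' | G.Adj x y}) ∧
      ∀ y ∈ B', d < #{x ∈ A' | G.Adj y x} := by
  classical
  induction hn : #A + #B using Nat.strong_induction_on generalizing A B with
  | _ n ih =>
    by_cases hA : ∃ x ∈ A, #{y ∈ B | G.Adj x y} ≤ d
    · obtain ⟨x, hx, hxd⟩ := hA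
      have hc := card_erase_add_one hx
      have hsub : ({p ∈ A ×ˢ B | G.Adj p.1 p.2} : Finset (V × V)) ⊆
          {p ∈ A.erase x ×ˢ B | G.Adj p.1 p.2} ∪ ({y ∈ B | G.Adj x y} : Finset V).image (x, ·) := by
        rintro ⟨a, b⟩ hp
        by_cases hax : a = x
        · subst hax; simp_all
        · simp_all
      have h1 := (card_le_card hsub).trans (card_union_le _ _)
      have h2 := card_image_le (s := ({y ∈ B | G.Adj x y} : Finset V)) (f := (x, ·))
      obtain ⟨A', hA', B', hB', H⟩ := ih (#(A.erase x) + #B) (by omega) (A.erase x) B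
        (by rw [← hc] at h; nlinarith) rfl
      exact ⟨A', hA'.trans (erase_subset _ _), B', hB', H⟩
    by_cases hB : ∃ y ∈ B, #{x ∈ A | G.Adj y x} ≤ d
    · obtain ⟨y, hy, hyd⟩ := hB
      have hc := card_erase_add_one hy
      have hsub : ({p ∈ A ×ˢ B | G.Adj p.1 p.2} : Finset (V × V)) ⊆
          {p ∈ A ×ˢ B.erase y | G.Adj p.1 p.2} ∪ ({x ∈ A | G.Adj y x} : Finset V).image (·, y) := by
        rintro ⟨a, b⟩ hp
        by_cases hby : b = y
        · subst hby; simp_all [G.adj_comm]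
        · simp_all
      have h1 := (card_le_card hsub).trans (card_union_le _ _)
      have h2 := card_image_le (s := ({x ∈ A | G.Adj y x} : Finset V)) (f := (·, y))
      obtain ⟨A', hA', B', hB', H⟩ := ih (#A + #(B.erase y)) (by omega) A (B.erase y)
        (by rw [← hc] at h; nlinarith) rfl
      exact ⟨A', hA', B', hB'.trans (erase_subset _ _), H⟩
    push Not at hA hB
    refine ⟨A, Subset.rfl, B, Subset.rfl, ?_, hA, hB⟩
    rw [nonempty_iff_ne_empty]
    rintro rfl
    simp at h

/-! ### Adjacent pairs between neighbourhoods in an `F`-free graph -/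

/-- If `B` lies in the neighbourhood of `v` and there were too many adjacent pairs in `A × B`, then
the forest left after deleting the apex of `F` could be embedded between `A` and `B`, with the
neighbours of the apex in `B`; sending the apex to `v` gives a copy of `F`. -/
theorem Free.card_filter_adj_le {W V : Type*} [Fintype W] {F : SimpleGraph W} {G : SimpleGraph V}
    [DecidableRel G.Adj] (hFG : F.Free G) (hF2 : F.IsBipartite) (hF1 : F.IsKAcyclic 1)
    (hW : 4 ≤ Fintype.card W) {A B : Finset V} {v : V} {D : ℕ} (hA : #A ≤ D) (hB : #B ≤ D)
    (hvA : v ∉ A) (hvB : ∀ y ∈ B, G.Adj v y) :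
    #{p ∈ A ×ˢ B | G.Adj p.1 p.2} ≤ 2 * (Fintype.card W - 3) * D := by
  classical
  by_contra! hlt
  set d := Fintype.card W - 3 with hd
  obtain ⟨X, hX, hac⟩ := hF1
  obtain ⟨w, rfl⟩ := card_eq_one.mp hX
  obtain ⟨c⟩ := hF2
  have hac' : (F.induce {x | x ≠ w}).IsAcyclic := by
    rwa [show {x | x ≠ w} = {x | x ∉ ({w} : Finset W)} by ext; simp]
  have hvB' : v ∉ B := fun h ↦ G.irrefl (hvB v h)
  have hBcard : 2 * d < #B := by
    have h1 : #{p ∈ A ×ˢ B | G.Adj p.1 p.2} ≤ D * #B :=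
      (card_filter_le _ _).trans (by rw [card_product]; gcongr)
    by_contra! h2
    nlinarith
  let U := {x | x ≠ w}
  have hUcard : Fintype.card U = d + 2 := by
    have : Fintype.card U = Fintype.card W - 1 := by
      simp [U, filter_ne']
    omega
  -- It suffices to embed the forest so that the neighbours of the apex go to neighbours of `v`.
  have key : ∀ f : U → V, Function.Injective f → (∀ a, f a ≠ v) →
      (∀ a : U, F.Adj w a → f a ∈ B) → (∀ a b : U, F.Adj a b → G.Adj (f a) (f b)) → False := by
    intro f hf hfv hfB hadj
    refine hFG ⟨⟨⟨fun x ↦ if h : x ≠ w then f ⟨x, h⟩ else v, ?_⟩, ?_⟩⟩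
    · intro x y hxy
      by_cases hx : x = w <;> by_cases hy : y = w
      · exact absurd (hx.trans hy.symm) hxy.ne
      · subst hx; simpa [hy] using hvB _ (hfB ⟨y, hy⟩ hxy)
      · subst hy; simpa [hx] using (hvB _ (hfB ⟨x, hx⟩ hxy.symm)).symm
      · simpa [hx, hy] using hadj ⟨x, hx⟩ ⟨y, hy⟩ hxy
    · intro x y hxy
      by_cases hx : x = w <;> by_cases hy : y = w
      · exact hx.trans hy.symm
      · simp [hx, hy] at hxy
        exact absurd hxy.symm (hfv _)
      · simp [hx, hy] at hxy
        exact absurd hxy (hfv _)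
      · simp [hx, hy] at hxy
        simpa using hf hxy
  by_cases he : ∃ a b : U, F.Adj a b
  · obtain ⟨a, b, hab⟩ := he
    obtain ⟨A', hA', B', hB', ⟨x, hx⟩, h1, h2⟩ :=
      G.exists_subset_forall_lt_card_filter_adj d A B (by nlinarith)
    have hB1 : d + 1 ≤ #B' := (h1 x hx).trans_le (card_filter_le _ _)
    obtain ⟨y, hy⟩ : B'.Nonempty := card_pos.mp (by omega)
    have hA1 : d + 1 ≤ #A' := (h2 y hy).trans_le (card_filter_le _ _)
    have : Nonempty V := ⟨v⟩
    have hcol : ∀ a b : W, F.Adj a b → decide (c b = c w) = !decide (c a = c w) := by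
      intro a b hab
      have := c.valid hab
      generalize c a = i at *
      generalize c b = j at *
      generalize c w = k at *
      revert i j k; decide
    obtain ⟨f, hf1, hf2, hf3⟩ := hac'.exists_embedding_of_le_card_filter_adj
      (fun x : U ↦ decide (c x = c w)) (fun a b hab ↦ hcol a b hab) G
      (fun b ↦ if b then A' else B') (d + 1)
      (by
        intro b x hx
        cases b
        · exact h2 x hx
        · exact h1 x hx)
      (by
        intro b
        cases b
        · exact hB1
        · exact hA1)
      univ (by rw [card_univ, hUcard]) (.inr ⟨a, mem_univ _, b, mem_univ _, hab⟩)
    refine key f (fun a b h ↦ hf1 (by simp) (by simp) h) ?_ ?_ ?_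
    · rintro a rfl
      have := hf2 a (mem_univ _)
      split_ifs at this
      · exact hvA (hA' this)
      · exact hvB' (hB' this)
    · intro a ha
      have := hf2 a (mem_univ _)
      rw [if_neg] at this
      · exact hB' this
      · simpa using (c.valid ha).symm
    · exact fun a b hab ↦ hf3 a (mem_univ _) b (mem_univ _) hab
  · push Not at he
    -- All edges of `F` contain the apex, so any injection into `B` will do.
    obtain ⟨g⟩ : Nonempty (U ↪ B) := Function.Embedding.nonempty_of_card_le (by
      rw [hUcard, Fintype.card_coe]; omega)
    exact key (fun x ↦ g x) (fun a b h ↦ g.injective (Subtype.ext h))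
      (fun a h ↦ hvB' (h ▸ (g a).2)) (fun a _ ↦ (g a).2) (fun a b hab ↦ absurd hab (he a b))

/-! ### Colourings that are acyclic on a set of vertices -/

variable {V : Type*} {G : SimpleGraph V}

/-- The map `c` restricts to an acyclic proper colouring of the subgraph induced by `S`; its values
outside `S` are arbitrary. -/
def IsAcyclicColoringOn {α : Type*} (G : SimpleGraph V) (c : V → α) (S : Finset V) : Prop :=
  (∀ x ∈ S, ∀ y ∈ S, G.Adj x y → c x ≠ c y) ∧
    ∀ (v : V) (p : G.Walk v v), p.IsCycle → (∀ x ∈ p.support, x ∈ S) →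
      ¬∃ a b, ∀ x ∈ p.support, c x = a ∨ c x = b

theorem IsAcyclicColoringOn.mono {α : Type*} {c : V → α} {S T : Finset V}
    (h : G.IsAcyclicColoringOn c S) (hTS : T ⊆ S) : G.IsAcyclicColoringOn c T :=
  ⟨fun x hx y hy ↦ h.1 x (hTS hx) y (hTS hy), fun v p hp hpT ↦ h.2 v p hp fun x hx ↦ hTS (hpT x hx)⟩

theorem IsAcyclicColoringOn.congr {α : Type*} {c c' : V → α} {S : Finset V}
    (h : G.IsAcyclicColoringOn c S) (hcc' : ∀ x ∈ S, c' x = c x) : G.IsAcyclicColoringOn c' S := by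
  refine ⟨fun x hx y hy hxy ↦ ?_, fun v p hp hpS ⟨a, b, hab⟩ ↦ h.2 v p hp hpS ⟨a, b, ?_⟩⟩
  · rw [hcc' x hx, hcc' y hy]
    exact h.1 x hx y hy hxy
  · intro x hx
    rw [← hcc' x (hpS x hx)]
    exact hab x hx

theorem IsAcyclicColoringOn.acyclicColorable [Fintype V] {k : ℕ} {c : V → Fin k}
    (h : G.IsAcyclicColoringOn c univ) : G.AcyclicColorable k := by
  refine ⟨Coloring.mk c fun {v w} hvw ↦ h.1 v (mem_univ v) w (mem_univ w) hvw, fun a b v p hp ↦ ?_⟩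
  let e := (Embedding.induce (G := G)
    ((Coloring.mk c fun {v w} hvw ↦ h.1 v (mem_univ v) w (mem_univ w) hvw).colorClass a ∪
      (Coloring.mk c fun {v w} hvw ↦ h.1 v (mem_univ v) w (mem_univ w) hvw).colorClass b)).toHom
  refine h.2 _ (p.map e) (hp.map Subtype.val_injective) (fun _ _ ↦ mem_univ _) ⟨a, b, fun x hx ↦ ?_⟩
  rw [Walk.support_map, List.mem_map] at hx
  obtain ⟨y, -, rfl⟩ := hx
  exact y.2

open Classical in
/-- The number of maps `V → Fin k` that are acyclic colourings on `S`. The values outside `S` are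
counted too, so that division by `k ^ |V|` gives the probability that a uniformly random map is an
acyclic colouring on `S`. -/
noncomputable def numAcyclicColoringsOn [Fintype V] (G : SimpleGraph V) (k : ℕ) (S : Finset V) :
    ℕ :=
  #{c : V → Fin k | G.IsAcyclicColoringOn c S}

/-- The decidability instances in the definition do not matter. -/
theorem card_filter_isAcyclicColoringOn [Fintype V] [DecidableEq V] (k : ℕ) (S : Finset V)
    [DecidablePred fun c : V → Fin k ↦ G.IsAcyclicColoringOn c S] :
    #{c : V → Fin k | G.IsAcyclicColoringOn c S} = G.numAcyclicColoringsOn k S := by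
  unfold numAcyclicColoringsOn
  congr!

theorem numAcyclicColoringsOn_empty [Fintype V] (k : ℕ) :
    G.numAcyclicColoringsOn k ∅ = k ^ Fintype.card V := by
  classical
  have h : ∀ c : V → Fin k, G.IsAcyclicColoringOn c ∅ := fun c ↦
    ⟨by simp, fun v p _ hp ↦ absurd (hp v p.start_mem_support) (by simp)⟩
  simp [numAcyclicColoringsOn, h]

/-- If the maps in `E` are acyclic colourings on a set `S` disjoint from `R`, and their values on
`R` are copied from positions outside `R`, then recolouring `R` arbitrarily shows that `E` contains
at most a proportion `k⁻¹ ^ |R|` of the acyclic colourings on `S`. -/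
theorem card_mul_pow_le_numAcyclicColoringsOn [Fintype V] {k : ℕ} {S R : Finset V}
    (hSR : Disjoint S R) (E : Finset (V → Fin k)) (hE : ∀ c ∈ E, G.IsAcyclicColoringOn c S)
    (hR : ∀ r ∈ R, ∃ s ∉ R, ∀ c ∈ E, c r = c s) :
    #E * k ^ #R ≤ G.numAcyclicColoringsOn k S := by
  classical
  have h1 : #E * k ^ #R = #(E ×ˢ (univ : Finset (R → Fin k))) := by simp [card_product]
  rw [h1]
  refine card_le_card_of_injOn (fun e x ↦ if h : x ∈ R then e.2 ⟨x, h⟩ else e.1 x) ?_ ?_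
  · rintro ⟨c, f⟩ hcf
    have hc : c ∈ E := by simpa using hcf
    simp only [coe_filter, mem_univ, true_and, Set.mem_ofPred_eq]
    exact (hE c hc).congr fun x hx ↦ dif_neg (Finset.disjoint_left.mp hSR hx)
  · rintro ⟨c, f⟩ hcf ⟨c', f'⟩ hcf' heq
    have hc : c ∈ E := by simpa using hcf
    have hc' : c' ∈ E := by simpa using hcf'
    have hout : ∀ x ∉ R, c x = c' x := fun x hx ↦ by simpa [hx] using congrFun heq x
    refine Prod.ext (funext fun x ↦ ?_) (funext fun x ↦ ?_)
    · by_cases hx : x ∈ R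
      · obtain ⟨s, hs, h⟩ := hR x hx
        exact (h c hc).trans ((hout s hs).trans (h c' hc').symm)
      · exact hout x hx
    · simpa using congrFun heq x

/-! ### Two-coloured cycles and the number of walks -/

/-- A two-coloured properly coloured cycle through `v` consists of a path `q` of odd length ending
at `v` and of two further vertices `x` and `y`, whose colours alternate along `q`. -/
theorem Walk.IsCycle.exists_alternating {α : Type*} {c : V → α} {v : V} {p : G.Walk v v}
    (hp : p.IsCycle) (hc : ∀ x ∈ p.support, ∀ y ∈ p.support, G.Adj x y → c x ≠ c y) {a b : α}
    (hab : ∀ x ∈ p.support, c x = a ∨ c x = b) :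
    ∃ (u x y : V) (q : G.Walk u v), q.IsPath ∧ Odd q.length ∧ G.Adj u x ∧ G.Adj x y ∧ G.Adj v y ∧
      x ∉ q.support ∧ y ∉ q.support ∧ x ∈ p.support ∧ y ∈ p.support ∧
      (∀ z ∈ q.support, z ∈ p.support) ∧
      ∀ i ≤ q.length, c (q.getVert i) = if Even i then c y else c x := by
  match p, hp, hc, hab with
  | .nil, hp, _, _ => exact absurd rfl hp.ne_nil
  | .cons h1 .nil, _, _, _ => exact absurd rfl h1.ne
  | .cons h1 (.cons h2 .nil), hp, _, _ => exact absurd hp.three_le_length (by simp)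
  | .cons (v := y) h1 (.cons (v := x) h2 (.cons (v := u) h3 q)), hp, hc, hab =>
    have hp1 := ((Walk.cons_isCycle_iff _ _).mp hp).1
    obtain ⟨hp2, hy⟩ := (Walk.cons_isPath_iff _ _).mp hp1
    obtain ⟨hq, hx⟩ := (Walk.cons_isPath_iff _ _).mp hp2
    have hsub : ∀ z ∈ q.support, z ∈ (Walk.cons h1 (.cons h2 (.cons h3 q))).support := by
      intro z hz; simp [hz]
    have hymem : y ∈ (Walk.cons h1 (.cons h2 (.cons h3 q))).support := by simp
    have hxmem : x ∈ (Walk.cons h1 (.cons h2 (.cons h3 q))).support := by simp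
    have htwo : ∀ r ∈ (Walk.cons h1 (.cons h2 (.cons h3 q))).support,
        ∀ s ∈ (Walk.cons h1 (.cons h2 (.cons h3 q))).support,
        ∀ t ∈ (Walk.cons h1 (.cons h2 (.cons h3 q))).support,
        G.Adj r s → G.Adj s t → c t = c r := by
      intro r hr s hs t ht hrs hst
      have h4 := hc r hr s hs hrs
      have h5 := hc s hs t ht hst
      rcases hab r hr with h6 | h6 <;> rcases hab s hs with h7 | h7 <;>
        rcases hab t ht with h8 | h8 <;> simp_all
    have halt : ∀ i ≤ q.length, c (q.getVert i) = if Even i then c y else c x := by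
      intro i
      induction i using Nat.twoStepInduction with
      | zero =>
        intro _
        simpa using htwo y hymem x hxmem u (hsub u q.start_mem_support) h2 h3
      | one =>
        intro hi
        simpa using htwo x hxmem u (hsub u q.start_mem_support) _
          (hsub _ (q.getVert_mem_support 1)) h3 (by simpa using q.adj_getVert_succ (i := 0) hi)
      | more i ih _ =>
        intro hi
        rw [htwo _ (hsub _ (q.getVert_mem_support i)) _ (hsub _ (q.getVert_mem_support (i + 1))) _
          (hsub _ (q.getVert_mem_support (i + 2))) (q.adj_getVert_succ (by omega))
          (q.adj_getVert_succ (by omega)), ih (by omega)]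
        simp [Nat.even_add]
    refine ⟨u, x, y, q, hq, ?_, h3.symm, h2.symm, h1, hx, fun h ↦ hy (by simp [h]), hxmem, hymem,
      hsub, halt⟩
    -- If `q` had even length, then its end `v` would have the colour of its neighbour `y`.
    rw [← Nat.not_even_iff_odd]
    intro heven
    have h4 := halt q.length le_rfl
    rw [Walk.getVert_length, if_pos heven] at h4
    exact hc v (by simp) y hymem h1 h4

theorem sum_card_finsetWalkLength_le [Fintype V] [DecidableEq V] [DecidableRel G.Adj] {Δ : ℕ}
    (hΔ : ∀ x, G.degree x ≤ Δ) (n : ℕ) (v : V) :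
    ∑ u, #(G.finsetWalkLength n u v) ≤ Δ ^ n := by
  induction n with
  | zero =>
    rw [sum_eq_single v]
    · simp [finsetWalkLength]
    · intro u _ huv
      simp [finsetWalkLength, huv]
    · simp
  | succ n ih =>
    calc ∑ u, #(G.finsetWalkLength (n + 1) u v)
        ≤ ∑ u, ∑ w ∈ G.neighborFinset u, #(G.finsetWalkLength n w v) := by
          refine sum_le_sum fun u _ ↦ ?_
          rw [finsetWalkLength]
          refine card_biUnion_le.trans (le_of_eq ?_)
          simp only [card_map]
          exact (sum_subtype (G.neighborFinset u) (by simp)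
            fun w ↦ #(G.finsetWalkLength n w v)).symm
      _ = ∑ w, ∑ u ∈ G.neighborFinset w, #(G.finsetWalkLength n w v) :=
          sum_comm' (by simp [G.adj_comm])
      _ = ∑ w, G.degree w * #(G.finsetWalkLength n w v) := by simp
      _ ≤ ∑ w, Δ * #(G.finsetWalkLength n w v) := by gcongr; exact hΔ _
      _ ≤ Δ ^ (n + 1) := by
          rw [← mul_sum, pow_succ']
          gcongr

/-! ### The counting argument -/

section Counting

variable [Fintype V]

/-- The one-vertex estimate `h`, iterated over the vertices of `S \ T`. -/
theorem numAcyclicColoringsOn_mul_pow_le [DecidableEq V] {k : ℕ} {β : ℝ} (hβ : 0 ≤ β)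
    {S T : Finset V} (hTS : T ⊆ S)
    (h : ∀ (R : Finset V) (v : V), v ∉ R → insert v R ⊆ S →
      β * G.numAcyclicColoringsOn k R ≤ k * G.numAcyclicColoringsOn k (insert v R)) :
    G.numAcyclicColoringsOn k T * β ^ #(S \ T) ≤
      (k : ℝ) ^ #(S \ T) * G.numAcyclicColoringsOn k S := by
  induction hn : #(S \ T) generalizing T with
  | zero =>
    have : T = S := hTS.antisymm (sdiff_eq_empty_iff_subset.mp (card_eq_zero.mp hn))
    simp [this]
  | succ n ih =>
    obtain ⟨v, hv⟩ : (S \ T).Nonempty := card_pos.mp (by omega)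
    have hv' := mem_sdiff.mp hv
    have hsub : insert v T ⊆ S := insert_subset hv'.1 hTS
    have hc : #(S \ insert v T) = n := by
      rw [sdiff_insert, card_erase_of_mem hv, hn]; rfl
    calc G.numAcyclicColoringsOn k T * β ^ (n + 1)
        = β * G.numAcyclicColoringsOn k T * β ^ n := by ring
      _ ≤ k * G.numAcyclicColoringsOn k (insert v T) * β ^ n := by
          gcongr ?_ * _
          exact h T v hv'.2 hsub
      _ = k * (G.numAcyclicColoringsOn k (insert v T) * β ^ n) := by ring
      _ ≤ k * ((k : ℝ) ^ n * G.numAcyclicColoringsOn k S) := by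
          gcongr ?_ * ?_
          exact ih hsub hc
      _ = (k : ℝ) ^ (n + 1) * G.numAcyclicColoringsOn k S := by ring

open Classical in
/-- The acyclic colourings on `S` that are made two-coloured on the cycle formed by the path `q`
and the edge `xy`. -/
noncomputable def alternatingColorings (k : ℕ) (S : Finset V) {u v : V} (q : G.Walk u v)
    (x y : V) : Finset (V → Fin k) :=
  {c | G.IsAcyclicColoringOn c S ∧
    ∀ i ≤ q.length, c (q.getVert i) = if Even i then c y else c x}

theorem mem_alternatingColorings {k : ℕ} {S : Finset V} {u v : V} {q : G.Walk u v} {x y : V}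
    {c : V → Fin k} : c ∈ G.alternatingColorings k S q x y ↔ G.IsAcyclicColoringOn c S ∧
      ∀ i ≤ q.length, c (q.getVert i) = if Even i then c y else c x := by
  simp [alternatingColorings]

/-- The colours on `q` are determined by those of `x` and `y`; forgetting the colours on `q` costs
a factor `k / β` for each vertex of `q` other than `v`. -/
theorem card_alternatingColorings_le {k : ℕ} (hk : 0 < k) {β : ℝ} (hβ : 0 < β) {S : Finset V}
    [DecidableEq V]
    (h : ∀ (R : Finset V) (v : V), v ∉ R → insert v R ⊆ S →
      β * G.numAcyclicColoringsOn k R ≤ k * G.numAcyclicColoringsOn k (insert v R))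
    {u v : V} (hv : v ∉ S) {q : G.Walk u v} (hq : q.IsPath)
    (hqS : ∀ z ∈ q.support, z ∈ insert v S) {x y : V} (hx : x ∉ q.support) (hy : y ∉ q.support) :
    (k : ℝ) * #(G.alternatingColorings k S q x y) ≤
      G.numAcyclicColoringsOn k S / β ^ q.length := by
  set R := q.support.toFinset with hR
  have hRcard : #R = q.length + 1 := by
    rw [hR, List.toFinset_card_of_nodup hq.support_nodup, Walk.length_support]
  have h1 : #(G.alternatingColorings k S q x y) * k ^ #R ≤
      G.numAcyclicColoringsOn k (S \ R) := by
    refine card_mul_pow_le_numAcyclicColoringsOn sdiff_disjoint _ ?_ ?_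
    · intro c hc
      exact (mem_alternatingColorings.mp hc).1.mono sdiff_subset
    · intro r hr
      obtain ⟨i, rfl, hi⟩ := Walk.mem_support_iff_exists_getVert.mp (List.mem_toFinset.mp hr)
      refine ⟨if Even i then y else x, ?_, fun c hc ↦ ?_⟩
      · split_ifs <;> simpa [hR]
      · rw [(mem_alternatingColorings.mp hc).2 i hi]
        split_ifs <;> rfl
  have h2 : S \ (S \ R) = R.erase v := by
    ext z
    have := hqS z
    simp only [hR, mem_sdiff, List.mem_toFinset, mem_erase, mem_insert] at *
    constructor
    · rintro ⟨hz, h3⟩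
      exact ⟨fun h ↦ hv (h ▸ hz), by tauto⟩
    · tauto
  have h3 : #(S \ (S \ R)) = q.length := by
    rw [h2, card_erase_of_mem (by simp [hR]), hRcard]; rfl
  have h4 := numAcyclicColoringsOn_mul_pow_le hβ.le (sdiff_subset : S \ R ⊆ S) h
  rw [h3] at h4
  rw [hRcard] at h1
  have h5 : (#(G.alternatingColorings k S q x y) : ℝ) * (k : ℝ) ^ (q.length + 1) ≤
      G.numAcyclicColoringsOn k (S \ R) := by exact_mod_cast h1
  have hk' : (0 : ℝ) < (k : ℝ) ^ q.length := by positivity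
  rw [le_div_iff₀ (by positivity)]
  refine le_of_mul_le_mul_left ?_ hk'
  calc (k : ℝ) ^ q.length * (k * #(G.alternatingColorings k S q x y) * β ^ q.length)
      = #(G.alternatingColorings k S q x y) * (k : ℝ) ^ (q.length + 1) * β ^ q.length := by ring
    _ ≤ G.numAcyclicColoringsOn k (S \ R) * β ^ q.length := by gcongr
    _ ≤ _ := h4

variable [DecidableRel G.Adj] [DecidableEq V]

/-- The pairs `(x, y)` that close the path `q` to a cycle. -/
def closingPairs {u v : V} (q : G.Walk u v) : Finset (V × V) :=
  {e ∈ (G.neighborFinset u \ q.support.toFinset) ×ˢ (G.neighborFinset v \ q.support.toFinset) |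
    G.Adj e.1 e.2}

open Classical in
/-- The paths of length `n` from `u` to `v` that lie in `insert v S`. -/
noncomputable def pathsIn (G : SimpleGraph V) [DecidableRel G.Adj] (S : Finset V) (n : ℕ)
    (u v : V) : Finset (G.Walk u v) :=
  {q ∈ G.finsetWalkLength n u v | q.IsPath ∧ ∀ z ∈ q.support, z ∈ insert v S}

/-- Adding a vertex `v` to `S` multiplies the proportion of acyclic colourings by at least `β / k`,
provided that this holds for all smaller sets. The colourings lost are those in which `v` has the
colour of a neighbour, and those with a two-coloured cycle through `v`. -/
theorem mul_numAcyclicColoringsOn_le_insert {k Δ M : ℕ} (hk : 0 < k) {β : ℝ} (hβ : 0 < β)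
    (hΔ : ∀ x, G.degree x ≤ Δ)
    (hM : ∀ (u v : V) (q : G.Walk u v), q.IsPath → 1 ≤ q.length → #(G.closingPairs q) ≤ M)
    (hsum : ∀ J : ℕ,
      Δ + β + ∑ j ∈ range J, (Δ : ℝ) ^ (2 * j + 1) * (M / β ^ (2 * j + 1)) ≤ k)
    (S : Finset V) (v : V) (hv : v ∉ S) :
    β * G.numAcyclicColoringsOn k S ≤ k * G.numAcyclicColoringsOn k (insert v S) := by
  classical
  induction hn : #S using Nat.strong_induction_on generalizing S v with
  | _ n ih =>
  subst hn
  have h : ∀ (R : Finset V) (v : V), v ∉ R → insert v R ⊆ S →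
      β * G.numAcyclicColoringsOn k R ≤ k * G.numAcyclicColoringsOn k (insert v R) := by
    intro R w hw hwR
    refine ih _ ?_ R w hw rfl
    have := card_le_card hwR
    rw [card_insert_of_notMem hw] at this
    omega
  set N := G.numAcyclicColoringsOn k S with hN
  let E₁ : V → Finset (V → Fin k) := fun y ↦ {c | G.IsAcyclicColoringOn c S ∧ c v = c y}
  let E₂ : ℕ → Finset (V → Fin k) := fun j ↦ univ.biUnion fun u ↦
    (G.pathsIn S (2 * j + 1) u v).biUnion fun q ↦
      (G.closingPairs q).biUnion fun e ↦ G.alternatingColorings k S q e.1 e.2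
  have hE₁ : ∀ y ∈ G.neighborFinset v, (k : ℝ) * #(E₁ y) ≤ N := by
    intro y hy
    have hvy : G.Adj v y := by simpa using hy
    have := card_mul_pow_le_numAcyclicColoringsOn (G := G) (S := S) (R := {v})
      (by simpa using hv) (E₁ y) (fun c hc ↦ (mem_filter.mp hc).2.1)
      (by
        intro r hr
        obtain rfl := mem_singleton.mp hr
        exact ⟨y, by simpa using hvy.ne', fun c hc ↦ (mem_filter.mp hc).2.2⟩)
    rw [card_singleton, pow_one, mul_comm] at this
    exact_mod_cast this
  have hE₂ : ∀ j, (k : ℝ) * #(E₂ j) ≤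
      (Δ : ℝ) ^ (2 * j + 1) * (M / β ^ (2 * j + 1)) * N := by
    intro j
    have h1 : ∀ u, ∀ q ∈ G.pathsIn S (2 * j + 1) u v, ∀ e ∈ G.closingPairs q,
        (k : ℝ) * #(G.alternatingColorings k S q e.1 e.2) ≤ N / β ^ (2 * j + 1) := by
      intro u q hq e he
      obtain ⟨hq1, hq2, hq3⟩ := mem_filter.mp hq
      rw [mem_finsetWalkLength_iff] at hq1
      simp only [closingPairs, mem_filter, mem_product, mem_sdiff, List.mem_toFinset] at he
      rw [← hq1]
      exact card_alternatingColorings_le hk hβ h hv hq2 hq3 he.1.1.2 he.1.2.2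
    have h2 : ∀ u, ∀ q ∈ G.pathsIn S (2 * j + 1) u v, #(G.closingPairs q) ≤ M := by
      intro u q hq
      obtain ⟨hq1, hq2, hq3⟩ := mem_filter.mp hq
      rw [mem_finsetWalkLength_iff] at hq1
      exact hM u v q hq2 (by omega)
    have h3 : (#(E₂ j) : ℝ) ≤ ∑ u, ∑ q ∈ G.pathsIn S (2 * j + 1) u v, ∑ e ∈ G.closingPairs q,
        (#(G.alternatingColorings k S q e.1 e.2) : ℝ) := by
      exact_mod_cast card_biUnion_le.trans (sum_le_sum fun u _ ↦
        card_biUnion_le.trans (sum_le_sum fun q _ ↦ card_biUnion_le))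
    have h4 : (∑ u, #(G.pathsIn S (2 * j + 1) u v) : ℝ) ≤ (Δ : ℝ) ^ (2 * j + 1) := by
      exact_mod_cast (sum_le_sum fun u _ ↦ card_filter_le _ _).trans
        (sum_card_finsetWalkLength_le hΔ (2 * j + 1) v)
    calc (k : ℝ) * #(E₂ j)
        ≤ k * ∑ u, ∑ q ∈ G.pathsIn S (2 * j + 1) u v, ∑ e ∈ G.closingPairs q,
            (#(G.alternatingColorings k S q e.1 e.2) : ℝ) := by gcongr
      _ = ∑ u, ∑ q ∈ G.pathsIn S (2 * j + 1) u v, ∑ e ∈ G.closingPairs q,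
            (k : ℝ) * #(G.alternatingColorings k S q e.1 e.2) := by simp only [mul_sum]
      _ ≤ ∑ u, ∑ q ∈ G.pathsIn S (2 * j + 1) u v, ∑ e ∈ G.closingPairs q,
            (N : ℝ) / β ^ (2 * j + 1) :=
          sum_le_sum fun u _ ↦ sum_le_sum fun q hq ↦ sum_le_sum fun e he ↦ h1 u q hq e he
      _ = ∑ u, ∑ q ∈ G.pathsIn S (2 * j + 1) u v,
            #(G.closingPairs q) * ((N : ℝ) / β ^ (2 * j + 1)) := by simp
      _ ≤ ∑ u, ∑ q ∈ G.pathsIn S (2 * j + 1) u v, M * ((N : ℝ) / β ^ (2 * j + 1)) := by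
          refine sum_le_sum fun u _ ↦ sum_le_sum fun q hq ↦ ?_
          gcongr
          exact h2 u q hq
      _ = (∑ u, #(G.pathsIn S (2 * j + 1) u v) : ℝ) * (M * ((N : ℝ) / β ^ (2 * j + 1))) := by
          simp [sum_mul]
      _ ≤ (Δ : ℝ) ^ (2 * j + 1) * (M * ((N : ℝ) / β ^ (2 * j + 1))) := by gcongr
      _ = _ := by ring
  -- A path has fewer than `|V|` edges, which bounds the lengths of the cycles.
  have hcover : ({c : V → Fin k | G.IsAcyclicColoringOn c S} : Finset _) ⊆
      (({c | G.IsAcyclicColoringOn c (insert v S)} : Finset _) ∪ (G.neighborFinset v).biUnion E₁) ∪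
        (range (Fintype.card V)).biUnion E₂ := by
    intro c hc
    have hcS : G.IsAcyclicColoringOn c S := (mem_filter.mp hc).2
    by_contra hnot
    simp only [mem_union, not_or, mem_filter, mem_univ, true_and, mem_biUnion, not_exists,
      not_and, mem_range, E₁] at hnot
    obtain ⟨⟨hins, hn1⟩, hn2⟩ := hnot
    have hvy : ∀ y, G.Adj v y → c v ≠ c y := fun y hy ↦ hn1 y (by simpa using hy) hcS
    have hproper : ∀ x ∈ insert v S, ∀ y ∈ insert v S, G.Adj x y → c x ≠ c y := by
      intro x hx y hy hxy
      rcases mem_insert.mp hx with rfl | hx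
      · exact hvy y hxy
      rcases mem_insert.mp hy with rfl | hy
      · exact (hvy x hxy.symm).symm
      exact hcS.1 x hx y hy hxy
    refine hins ⟨hproper, fun w p hp hpS ⟨a, b, hab⟩ ↦ ?_⟩
    by_cases hvp : v ∈ p.support
    · have hmem : ∀ z, z ∈ (p.rotate v hvp).support ↔ z ∈ p.support := fun z ↦
        p.mem_support_rotate_iff v hvp
      obtain ⟨u, x, y, q, hq, ⟨j, hj⟩, hux, hxy, hvy', hxq, hyq, hx, hy, hqp, halt⟩ :=
        (hp.rotate hvp).exists_alternating (c := c) (a := a) (b := b)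
          (fun x hx y hy ↦ hproper x (hpS x ((hmem x).mp hx)) y (hpS y ((hmem y).mp hy)))
          (fun x hx ↦ hab x ((hmem x).mp hx))
      have hlen := hq.length_lt
      refine hn2 j (by omega) (mem_biUnion.mpr ⟨u, mem_univ u, mem_biUnion.mpr ⟨q, ?_,
        mem_biUnion.mpr ⟨(x, y), ?_, ?_⟩⟩⟩)
      · exact mem_filter.mpr ⟨mem_finsetWalkLength_iff.mpr hj, hq,
          fun z hz ↦ hpS z ((hmem z).mp (hqp z hz))⟩
      · simp [closingPairs, hux, hxy, hvy', hxq, hyq]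
      · exact mem_alternatingColorings.mpr ⟨hcS, halt⟩
    · refine hcS.2 w p hp (fun x hx ↦ ?_) ⟨a, b, hab⟩
      exact (mem_insert.mp (hpS x hx)).resolve_left fun h ↦ hvp (h ▸ hx)
  have hcard : (N : ℝ) ≤ G.numAcyclicColoringsOn k (insert v S) +
      ∑ y ∈ G.neighborFinset v, (#(E₁ y) : ℝ) +
      ∑ j ∈ range (Fintype.card V), (#(E₂ j) : ℝ) := by
    have h1 : N ≤ G.numAcyclicColoringsOn k (insert v S) + ∑ y ∈ G.neighborFinset v, #(E₁ y) +
        ∑ j ∈ range (Fintype.card V), #(E₂ j) := by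
      rw [hN, ← card_filter_isAcyclicColoringOn, ← card_filter_isAcyclicColoringOn]
      exact (card_le_card hcover).trans ((card_union_le _ _).trans
      (add_le_add ((card_union_le _ _).trans (add_le_add le_rfl card_biUnion_le)) card_biUnion_le))
    exact_mod_cast h1
  have hd : (G.degree v : ℝ) ≤ Δ := by exact_mod_cast hΔ v
  have hs1 : (k : ℝ) * ∑ y ∈ G.neighborFinset v, (#(E₁ y) : ℝ) ≤ Δ * N := by
    rw [mul_sum]
    refine (sum_le_sum hE₁).trans ?_
    simp only [sum_const, card_neighborFinset_eq_degree, nsmul_eq_mul]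
    gcongr
  have hs2 : (k : ℝ) * ∑ j ∈ range (Fintype.card V), (#(E₂ j) : ℝ) ≤
      (∑ j ∈ range (Fintype.card V), (Δ : ℝ) ^ (2 * j + 1) * (M / β ^ (2 * j + 1))) * N := by
    rw [mul_sum, sum_mul]
    exact sum_le_sum fun j _ ↦ hE₂ j
  have hs3 := mul_le_mul_of_nonneg_right (hsum (Fintype.card V)) (Nat.cast_nonneg (α := ℝ) N)
  have hs4 := mul_le_mul_of_nonneg_left hcard (Nat.cast_nonneg (α := ℝ) k)
  linarith

/-- The hypothesis `hsum` says that `k` colours outweigh the colours forbidden at a new vertex, in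
the weighted count over all cycle lengths, with `β` to spare. -/
theorem acyclicColorable_of_card_closingPairs_le {k Δ M : ℕ} (hk : 0 < k) {β : ℝ} (hβ : 0 < β)
    (hΔ : ∀ x, G.degree x ≤ Δ)
    (hM : ∀ (u v : V) (q : G.Walk u v), q.IsPath → 1 ≤ q.length → #(G.closingPairs q) ≤ M)
    (hsum : ∀ J : ℕ,
      Δ + β + ∑ j ∈ range J, (Δ : ℝ) ^ (2 * j + 1) * (M / β ^ (2 * j + 1)) ≤ k) :
    G.AcyclicColorable k := by
  classical
  have h := numAcyclicColoringsOn_mul_pow_le (G := G) (k := k) hβ.le (empty_subset univ)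
    fun R v hv _ ↦ mul_numAcyclicColoringsOn_le_insert hk hβ hΔ hM hsum R v hv
  rw [numAcyclicColoringsOn_empty] at h
  have hk' : (0 : ℝ) < k := by exact_mod_cast hk
  have hpos : 0 < G.numAcyclicColoringsOn k univ := by
    by_contra! h0
    rw [Nat.le_zero.mp h0, Nat.cast_zero, mul_zero] at h
    exact absurd h (not_le.mpr (by positivity))
  obtain ⟨c, hc⟩ := card_pos.mp hpos
  exact (mem_filter.mp hc).2.acyclicColorable

end Counting

/-! ### Acyclic colourings of `F`-free graphs -/

/-- Both neighbourhoods lose the neighbour that lies on the path, so they have at most `Δ - 1`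
vertices left. -/
theorem Free.card_closingPairs_le {W V : Type*} [Fintype W] [Fintype V] [DecidableEq V]
    {F : SimpleGraph W} {G : SimpleGraph V} [DecidableRel G.Adj] (hFG : F.Free G)
    (hF2 : F.IsBipartite) (hF1 : F.IsKAcyclic 1) (hW : 4 ≤ Fintype.card W) {Δ : ℕ}
    (hΔ : ∀ x, G.degree x ≤ Δ) {u v : V} {q : G.Walk u v} (hlen : 1 ≤ q.length) :
    #(G.closingPairs q) ≤ 2 * (Fintype.card W - 3) * (Δ - 1) := by
  have hnil : ¬q.Nil := fun h ↦ by
    have := Walk.length_eq_zero_iff.mpr h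
    omega
  have key : ∀ a b : V, G.Adj a b → b ∈ q.support →
      #(G.neighborFinset a \ q.support.toFinset) ≤ Δ - 1 := by
    intro a b hab hb
    have h1 : G.neighborFinset a \ q.support.toFinset ⊆ (G.neighborFinset a).erase b := by
      intro z hz
      rw [mem_sdiff, List.mem_toFinset] at hz
      exact mem_erase.mpr ⟨fun h ↦ hz.2 (h ▸ hb), hz.1⟩
    have h2 := card_le_card h1
    rw [card_erase_of_mem (by simpa using hab), card_neighborFinset_eq_degree] at h2
    exact h2.trans (Nat.sub_le_sub_right (hΔ a) 1)
  exact hFG.card_filter_adj_le hF2 hF1 hW (v := v)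
    (key u _ (q.adj_snd hnil) (q.getVert_mem_support 1))
    (key v _ (q.adj_penultimate hnil).symm (q.getVert_mem_support _))
    (by simp) (fun y hy ↦ by simpa using (mem_sdiff.mp hy).1)

/-- Bound for a geometric series in which every second term is taken. -/
theorem sum_range_odd_pow_le {s : ℝ} (hs : 1 < s) (J : ℕ) :
    ∑ j ∈ range J, (1 / s) ^ (2 * j + 1) ≤ s / (s ^ 2 - 1) := by
  have h1 : 0 < s ^ 2 - 1 := by nlinarith
  have h0 : 0 < s := by linarith
  have h2 : ∀ J : ℕ, ∑ j ∈ range J, (1 / s) ^ (2 * j + 1) =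
      s / (s ^ 2 - 1) * (1 - (1 / s) ^ (2 * J)) := by
    intro J
    induction J with
    | zero => simp
    | succ J ih =>
      rw [sum_range_succ, ih, show 2 * (J + 1) = 2 * J + 2 by ring,
        pow_add (1 / s) (2 * J) 2, pow_add (1 / s) (2 * J) 1]
      generalize (1 / s) ^ (2 * J) = r
      field_simp
      ring
  rw [h2]
  have h3 : 0 ≤ (1 / s) ^ (2 * J) := by positivity
  have h4 : 0 < s / (s ^ 2 - 1) := by positivity
  nlinarith

end SimpleGraph

open SimpleGraph

theorem mainTheorem4 :
    ∃ C : ℝ, 0 < C ∧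
      ∀ (W : Type*) (V : Type*) [Fintype W] [Fintype V]
        (F : SimpleGraph W) (G : SimpleGraph V) [DecidableRel G.Adj] (t Δ : ℕ),
        Fintype.card W = t → 4 ≤ t → F.IsBipartite → F.IsKAcyclic 1 →
        F.Free G → G.maxDegree = Δ → 1 ≤ Δ →
          (G.acyclicChromaticNumber : ℝ) ≤ (1 + Real.sqrt (8 * (t : ℝ) - 20)) * (Δ : ℝ) ∧
          (1 + Real.sqrt (8 * (t : ℝ) - 20)) * (Δ : ℝ) ≤ C * (Real.sqrt (t : ℝ) * (Δ : ℝ)) := by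
  refine ⟨4, by norm_num, ?_⟩
  intro W V _ _ F G _ t Δ hW ht hF2 hF1 hFG hmax hΔ1
  classical
  have ht' : (4 : ℝ) ≤ t := by exact_mod_cast ht
  have hΔ1' : (1 : ℝ) ≤ Δ := by exact_mod_cast hΔ1
  constructor
  · set s := Real.sqrt (2 * t - 5) with hs
    have hs2 : s ^ 2 = 2 * t - 5 := Real.sq_sqrt (by linarith)
    have hs0 : 0 ≤ s := Real.sqrt_nonneg _
    have hs1 : 1 < s := by nlinarith
    have hsqrt : Real.sqrt (8 * t - 20) = 2 * s := by
      rw [show (8 * t - 20 : ℝ) = (2 * s) ^ 2 by rw [mul_pow, hs2]; ring]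
      exact Real.sqrt_sq (by positivity)
    rw [hsqrt]
    set k := ⌊(1 + 2 * s) * (Δ : ℝ)⌋₊ with hk
    have hk1 : (k : ℝ) ≤ (1 + 2 * s) * Δ := Nat.floor_le (by positivity)
    have hk2 : (1 + 2 * s) * (Δ : ℝ) < k + 1 := Nat.lt_floor_add_one _
    have hΔ : ∀ x, G.degree x ≤ Δ := fun x ↦ hmax ▸ G.degree_le_maxDegree x
    have hcol : G.AcyclicColorable k := by
      have hk0 : (0 : ℝ) < k := by nlinarith
      refine acyclicColorable_of_card_closingPairs_le (β := s * Δ)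
        (M := 2 * (t - 3) * (Δ - 1)) (by exact_mod_cast hk0) (by positivity) hΔ ?_ ?_
      · intro u v q _ hlen
        subst hW
        exact hFG.card_closingPairs_le hF2 hF1 ht hΔ hlen
      · intro J
        have hM : ((2 * (t - 3) * (Δ - 1) : ℕ) : ℝ) = (s ^ 2 - 1) * (Δ - 1) := by
          push_cast [Nat.cast_sub (by omega : 3 ≤ t), Nat.cast_sub hΔ1]
          rw [hs2]; ring
        rw [hM]
        have hterm : ∀ j, (Δ : ℝ) ^ (2 * j + 1) *
            ((s ^ 2 - 1) * (Δ - 1) / (s * Δ) ^ (2 * j + 1)) =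
            (s ^ 2 - 1) * (Δ - 1) * (1 / s) ^ (2 * j + 1) := by
          intro j
          rw [mul_pow, one_div, inv_pow]
          field_simp
        simp only [hterm, ← mul_sum]
        have h1 : 0 < s ^ 2 - 1 := by nlinarith
        have h2 : (s ^ 2 - 1) * (Δ - 1) * ∑ j ∈ range J, (1 / s) ^ (2 * j + 1) ≤ s * (Δ - 1) := by
          calc _ ≤ (s ^ 2 - 1) * (Δ - 1) * (s / (s ^ 2 - 1)) := by
                have := sum_range_odd_pow_le hs1 J
                have h3 : 0 ≤ (s ^ 2 - 1) * ((Δ : ℝ) - 1) := mul_nonneg h1.le (by linarith)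
                gcongr
            _ = s * (Δ - 1) := by field_simp
        -- The gain `s > 1` from counting `Δ - 1` instead of `Δ` pays for rounding down to `k`.
        linarith
    exact le_trans (by exact_mod_cast Nat.sInf_le hcol) hk1
  · have h1 : 1 ≤ Real.sqrt t := Real.one_le_sqrt.mpr (by linarith)
    have h2 : Real.sqrt (8 * t - 20) ≤ 3 * Real.sqrt t := by
      rw [Real.sqrt_le_left (by positivity), mul_pow, Real.sq_sqrt (by positivity)]
      linarith
    rw [← mul_assoc]
    gcongr
    linarith
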